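/- A partition $\lambda\vdash n$ is identified with its Ferrers diagram, whose cells $(i,j)$ (row $i$, column $j$) are left-justified with weakly decreasing row lengths. Let $f^\lambda$ be the number of standard Young tableaux of shape $\lambda$, i.e. of bijective fillings of the cells with $1,\dots,n$ that increase strictly along rows and down columns, and let $v_2(m)$ be the exponent of $2$ in the prime factorization of $m$. A removable domino of $\lambda$ is a pair of horizontally or vertically adjacent cells whose removal leaves the Ferrers diagram of a partition; a partition without removable dominoes is a 2-core. Successive removal of dominoes from $\lambda$ always ends in the same 2-core, denoted $\mathrm{core}_2(\lambda)$. Label the cell $(i,j)$ with $0$ if $i+j$ is even and with $1$ if $i+j$ is odd. For $\varepsilon\in\{0,1\}$ let $\lambda^{(\varepsilon)}$ be the partition formed by the cells $(i,j)$ of $\lambda$ such that the rightmost cell of row $i$ has label $\varepsilon$ and the bottom cell of column $j$ has label $1-\varepsilon$ (deleting all other rows and columns). For binary strings put $\lambda^{(\varnothing)}=\lambda$ and $\lambda^{(b\varepsilon)}=(\lambda^{(b)})^{(\varepsilon)}$. The $k$-th row of the 2-core tower of $\lambda$ consists of the 2-cores $\mathrm{core}_2(\lambda^{(b)})$, $b\in\{0,1\}^k$;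 for $k\ge 0$ put \[ w_k(\lambda):=\sum_{b\in\{0,1\}^k}\bigl|\mathrm{core}_2(\lambda^{(b)})\bigr|. \] Write $n=\sum_{i\ge 0}b_i2^i$ with $b_i\in\{0,1\}$, and let $\mathrm{bin}'(n):=\{i\ge 1 : b_i=1\}$. **Proposition.** Let $n\ge 0$ and let $\lambda$ be a partition of $n$. Then $v_2(f^\lambda)=1$ if and only if there is some $R\in\mathrm{bin}'(n)$ such that $w_{R-1}(\lambda)=b_{R-1}+2$, $w_R(\lambda)=0$, and $w_i(\lambda)=b_i$ for all $i\ge 0$ with $i\ne R,\,R-1$. -/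

import Mathlib

namespace TwoCoreTower

/-- A standard filling of the Young diagram `μ`: the cells are numbered bijectively by
`Fin |μ|` (that is, by `1, …, |μ|`, shifted to start at `0`), strictly increasing along every
row (left to right) and every column (top to bottom). A cell is a pair `(i, j)` = (row, column),
both counted from `0`. -/
def IsStandardTableau (μ : YoungDiagram) (T : μ.cells ≃ Fin μ.card) : Prop :=
  (∀ c d : μ.cells, c.1.1 = d.1.1 → c.1.2 < d.1.2 → T c < T d) ∧
  (∀ c d : μ.cells, c.1.2 = d.1.2 → c.1.1 < d.1.1 → T c < T d)

/-- The dimension `f^μ`: the number of standard Young tableaux of shape `μ`. -/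
noncomputable def dimension (μ : YoungDiagram) : ℕ :=
  Nat.card {T : μ.cells ≃ Fin μ.card // IsStandardTableau μ T}

/-- `ν` is obtained from `μ` by removing a domino (two horizontally or vertically adjacent cells
of `μ`); that the remaining cells again form a Young diagram is part of `ν : YoungDiagram`. -/
def RemovesDomino (μ ν : YoungDiagram) : Prop :=
  ∃ i j : ℕ,
    ((i, j) ∈ μ ∧ (i, j + 1) ∈ μ ∧ ν.cells = μ.cells \ {(i, j), (i, j + 1)}) ∨
    ((i, j) ∈ μ ∧ (i + 1, j) ∈ μ ∧ ν.cells = μ.cells \ {(i, j), (i + 1, j)})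

/-- A 2-core is a partition without a removable domino. -/
def IsTwoCore (μ : YoungDiagram) : Prop :=
  ∀ ν : YoungDiagram, ¬ RemovesDomino μ ν

theorem RemovesDomino.card_lt {μ ν : YoungDiagram} (h : RemovesDomino μ ν) :
    ν.card < μ.card := by
  obtain ⟨i, j, ⟨h1, _, h3⟩ | ⟨h1, _, h3⟩⟩ := h <;>
  · apply Finset.card_lt_card
    rw [h3]
    exact Finset.ssubset_iff_subset_ne.2 ⟨Finset.sdiff_subset, fun he => by
      have h4 : (i, j) ∈ μ.cells := h1
      rw [← he] at h4
      simp at h4⟩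

theorem exists_twoCore (μ : YoungDiagram) :
    ∃ ν : YoungDiagram, Relation.ReflTransGen RemovesDomino μ ν ∧ IsTwoCore ν := by
  induction hn : μ.card using Nat.strong_induction_on generalizing μ with
  | _ n ih =>
    by_cases hc : IsTwoCore μ
    · exact ⟨μ, .refl, hc⟩
    · unfold IsTwoCore at hc
      push Not at hc
      obtain ⟨ν, hν⟩ := hc
      obtain ⟨ρ, h1, h2⟩ := ih ν.card (hn ▸ hν.card_lt) ν rfl
      exact ⟨ρ, .head hν h1, h2⟩

/-- The 2-core of `μ`: the 2-core reached from `μ` by successively removing dominoes. -/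
noncomputable def core (μ : YoungDiagram) : YoungDiagram :=
  (exists_twoCore μ).choose

theorem core_spec (μ : YoungDiagram) :
    Relation.ReflTransGen RemovesDomino μ (core μ) ∧ IsTwoCore (core μ) :=
  (exists_twoCore μ).choose_spec

/-- The label of the cell `(i, j)`: `false` (standing for `0`) if `i + j` is even and `true`
(standing for `1`) if `i + j` is odd. Counting both rows and columns from `0` instead of `1`
does not change the parity of `i + j`. -/
def label (i j : ℕ) : Bool := (i + j).bodd

/-- The label of the rightmost cell of the (nonempty) row `i` of `μ`. -/
def rowEnd (μ : YoungDiagram) (i : ℕ) : Bool := label i (μ.rowLen i - 1)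

/-- The label of the bottom cell of the (nonempty) column `j` of `μ`. -/
def colEnd (μ : YoungDiagram) (j : ℕ) : Bool := label (μ.colLen j - 1) j

/-- The number of cells `(i, j)` of `μ` in row `i` whose column ends in a label other than `ε`. -/
def quotientRowLen (ε : Bool) (μ : YoungDiagram) (i : ℕ) : ℕ :=
  ((Finset.range (μ.rowLen i)).filter fun j => colEnd μ j = !ε).card

/-- The row lengths of the `ε`-th component of the 2-quotient: from the nonempty rows of `μ`, keep
those ending in label `ε`, and in each of these count the cells whose column ends in `1 - ε`. -/
def quotientRowLens (ε : Bool) (μ : YoungDiagram) : List ℕ :=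
  ((List.range (μ.colLen 0)).filter fun i => rowEnd μ i = ε).map (quotientRowLen ε μ)

theorem quotientRowLens_sortedGE (ε : Bool) (μ : YoungDiagram) :
    (quotientRowLens ε μ).SortedGE := by
  apply List.Pairwise.sortedGE
  unfold quotientRowLens
  rw [List.pairwise_map]
  refine List.Pairwise.filter _ (List.pairwise_lt_range.imp fun {a b} hab => ?_)
  exact Finset.card_le_card (Finset.filter_subset_filter _
    (Finset.range_subset_range.2 (μ.rowLen_anti a b hab.le)))

/-- The component `μ^(ε)` of the 2-quotient of `μ`: the partition formed by the cells `(i, j)` of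
`μ` such that row `i` ends in label `ε` and column `j` ends in label `1 - ε`
(with the unused rows and columns deleted). -/
def quotient (ε : Bool) (μ : YoungDiagram) : YoungDiagram :=
  YoungDiagram.ofRowLens (quotientRowLens ε μ) (quotientRowLens_sortedGE ε μ)

/-- The partition `μ^(b)` for a binary string `b`: `μ^(∅) = μ` and
`μ^(b ε) = (μ^(b))^(ε)`. -/
def iteratedQuotient (μ : YoungDiagram) (b : List Bool) : YoungDiagram :=
  b.foldl (fun ν ε => quotient ε ν) μ

/-- `w_k(μ)`: the sum of the sizes of the 2-cores in the `k`-th row of the 2-core tower of `μ`,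
whose nodes are labelled by `core (μ^(b))` for the binary strings `b` of length `k`. -/
noncomputable def rowWeight (μ : YoungDiagram) (k : ℕ) : ℕ :=
  ∑ b : Fin k → Bool, (core (iteratedQuotient μ (List.ofFn b))).card

/-- The `i`-th binary digit of `n`, as a natural number `0` or `1`. -/
def binDigit (n i : ℕ) : ℕ := (n.testBit i).toNat

/-- The set `bin(n)` of positions of the ones in the binary expansion of `n`. -/
def bin (n : ℕ) : Set ℕ := {i | binDigit n i = 1}

/-- The set `bin'(n) = bin(n) \ {0}`. -/
def bin' (n : ℕ) : Set ℕ := bin n \ {0}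

end TwoCoreTower

/-!
The proof computes the 2-adic valuation of `f^μ` exactly: with `n = |μ|`,

  `v₂(f^μ) = ∑ k, w_k(μ) - ∑ i, b_i`   (`valuation_dimension`),

where `∑ k, 2 ^ k w_k(μ) = n` (`sum_two_pow_mul_rowWeight`). So `v₂(f^μ) = 1` says that the `w_k(μ)`
are the coefficients of an expansion of `n` in powers of `2` whose digit sum exceeds the least
possible one by `1`. Such an expansion becomes the binary one by a single carry, from some position
`R - 1` to `R` (`exists_carry_position`), and this is the condition of the theorem.

The valuation is obtained without hook lengths. Let `x_i = μ_i + (m - 1 - i)` for `i < m` be the beta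
numbers of `μ`. Frobenius' formula `f^μ ∏ x_i! = n! ∏_{i<j} (x_i - x_j)`
(`dimension_mul_prod_factorial`) follows by induction on `n` from the branching rule
(`dimension_eq_sum`), since the right-hand side satisfies the same recursion
(`sum_mul_diffProd_update`). The beta numbers of the two components of the 2-quotient are the halves
of the even and of the odd beta numbers of `μ` (`betaSet_quotient`). As `v₂((2a + r)!) = a + v₂(a!)`
for `r < 2`, and differences of numbers of distinct parities are odd, Frobenius' formula for `μ` and
for the components gives a recursion for `v₂(n!) - v₂(f^μ)` along the 2-quotient
(`valuation_recursion`).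

The other ingredient is `|μ| = |core μ| + 2 (|μ^(0)| + |μ^(1)|)` (`card_eq_card_core_add`). With `d`
the number of cells labelled `0` minus the number of those labelled `1`, beta numbers show that
`|μ| - 2 (|μ^(0)| + |μ^(1)|) = d (2 d - 1)`. Removing a domino does not change `d`, and a 2-core is a
staircase, whose 2-quotient is empty.
-/

namespace TwoCoreTower

open Finset

/-! ### Removing a corner -/

/-- The diagram `μ` without the last cell of row `i`, which is a corner because the next row is
shorter. -/
def eraseCorner (μ : YoungDiagram) (i : ℕ) (h : μ.rowLen (i + 1) < μ.rowLen i) :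
    YoungDiagram where
  cells := μ.cells.erase (i, μ.rowLen i - 1)
  isLowerSet := by
    rintro ⟨a, b⟩ ⟨c, d⟩ ⟨hac, hbd⟩ hm
    simp only [coe_erase, Set.mem_sdiff, mem_coe, YoungDiagram.mem_cells, Set.mem_singleton_iff,
      Prod.mk.injEq] at hm ⊢
    simp only at hac hbd
    refine ⟨μ.up_left_mem hac hbd hm.1, ?_⟩
    rintro ⟨rfl, rfl⟩
    have h1 := YoungDiagram.mem_iff_lt_rowLen.1 hm.1
    rcases hac.eq_or_lt with rfl | hac
    · exact hm.2 ⟨rfl, by omega⟩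
    · have := μ.rowLen_anti (c + 1) a hac
      omega

theorem cells_eraseCorner {μ : YoungDiagram} {i : ℕ} (h : μ.rowLen (i + 1) < μ.rowLen i) :
    (eraseCorner μ i h).cells = μ.cells.erase (i, μ.rowLen i - 1) := rfl

theorem corner_mem {μ : YoungDiagram} {i : ℕ} (h : μ.rowLen (i + 1) < μ.rowLen i) :
    (i, μ.rowLen i - 1) ∈ μ.cells := by
  rw [YoungDiagram.mem_cells, YoungDiagram.mem_iff_lt_rowLen]
  omega

theorem card_eraseCorner {μ : YoungDiagram} {i : ℕ} (h : μ.rowLen (i + 1) < μ.rowLen i) :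
    (eraseCorner μ i h).card + 1 = μ.card :=
  Finset.card_erase_add_one (corner_mem h)

theorem rowLen_eraseCorner {μ : YoungDiagram} {i : ℕ} (h : μ.rowLen (i + 1) < μ.rowLen i)
    (k : ℕ) : (eraseCorner μ i h).rowLen k = if k = i then μ.rowLen i - 1 else μ.rowLen k := by
  refine eq_of_forall_lt_iff fun j => ?_
  rw [← YoungDiagram.mem_iff_lt_rowLen, ← YoungDiagram.mem_cells]
  simp only [eraseCorner, mem_erase, YoungDiagram.mem_cells, YoungDiagram.mem_iff_lt_rowLen, ne_eq,
    Prod.mk.injEq]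
  split_ifs with hk
  · subst hk; omega
  · simp [hk]

theorem rowLen_eq_zero_iff {μ : YoungDiagram} {i : ℕ} : μ.rowLen i = 0 ↔ μ.colLen 0 ≤ i := by
  rw [← not_lt, ← YoungDiagram.mem_iff_lt_colLen, YoungDiagram.mem_iff_lt_rowLen]
  omega

theorem rowLen_pos_iff {μ : YoungDiagram} {i : ℕ} : 0 < μ.rowLen i ↔ i < μ.colLen 0 := by
  rw [← YoungDiagram.mem_iff_lt_colLen, YoungDiagram.mem_iff_lt_rowLen]

theorem colLen_eraseCorner_le {μ : YoungDiagram} {i : ℕ} (h : μ.rowLen (i + 1) < μ.rowLen i) :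
    (eraseCorner μ i h).colLen 0 ≤ μ.colLen 0 := by
  rw [← rowLen_eq_zero_iff, rowLen_eraseCorner]
  have := rowLen_eq_zero_iff.2 (le_refl (μ.colLen 0))
  split_ifs with hk
  · rw [← hk]; omega
  · exact this

theorem sum_cells {M : Type*} [AddCommMonoid M] (μ : YoungDiagram) {m : ℕ} (hm : μ.colLen 0 ≤ m)
    (f : ℕ → ℕ → M) :
    ∑ c ∈ μ.cells, f c.1 c.2 = ∑ i ∈ range m, ∑ j ∈ range (μ.rowLen i), f i j := by
  rw [Finset.sum_sigma']
  refine Finset.sum_bij' (fun c _ => ⟨c.1, c.2⟩) (fun c _ => (c.1, c.2)) ?_ ?_ ?_ ?_ ?_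
  · rintro ⟨i, j⟩ h
    simp only [mem_sigma, mem_range]
    rw [YoungDiagram.mem_cells] at h
    exact ⟨((YoungDiagram.mem_iff_lt_colLen.1 h).trans_le (μ.colLen_anti 0 j (Nat.zero_le _))).trans_le
      hm, YoungDiagram.mem_iff_lt_rowLen.1 h⟩
  · rintro ⟨i, j⟩ h
    simp only [mem_sigma, mem_range] at h
    rw [YoungDiagram.mem_cells, YoungDiagram.mem_iff_lt_rowLen]
    exact h.2
  all_goals simp

theorem card_eq_sum_rowLen (μ : YoungDiagram) {m : ℕ} (hm : μ.colLen 0 ≤ m) :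
    μ.card = ∑ i ∈ range m, μ.rowLen i := by
  have := sum_cells μ hm (fun _ _ => 1)
  simpa using this

/-! ### The branching rule -/

/-- Standard tableaux of shape `μ`, encoded as functions on `ℕ × ℕ` with entries `1, …, |μ|` on the
cells of `μ` and the value `0` elsewhere. -/
def tableaux (μ : YoungDiagram) : Set (ℕ × ℕ → ℕ) :=
  {t | (∀ c ∉ μ.cells, t c = 0) ∧ Set.BijOn t μ.cells (Set.Icc 1 μ.card) ∧
    ∀ c ∈ μ.cells, ∀ d ∈ μ.cells,
      (c.1 = d.1 ∧ c.2 < d.2 ∨ c.2 = d.2 ∧ c.1 < d.1) → t c < t d}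

/-- The function encoding a tableau shifts the entries from `0, …, |μ| - 1` to `1, …, |μ|`. -/
theorem exists_bijective_tableaux (μ : YoungDiagram) :
    ∃ F : {T : μ.cells ≃ Fin μ.card // IsStandardTableau μ T} → tableaux μ,
      Function.Bijective F := by
  classical
  refine ⟨fun T => ⟨fun c => if h : c ∈ μ.cells then (T.1 ⟨c, h⟩ : ℕ) + 1 else 0, ?_, ?_, ?_⟩, ?_, ?_⟩
  · intro c hc
    simp [hc]
  · refine ⟨?_, ?_, ?_⟩
    · intro c hc
      rw [mem_coe] at hc
      have := (T.1 ⟨c, hc⟩).2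
      simp only [hc, dite_true, Set.mem_Icc]
      omega
    · intro c hc d hd hcd
      rw [mem_coe] at hc hd
      simp only [hc, hd, dite_true, add_left_inj] at hcd
      have := T.1.injective (Fin.ext hcd)
      simpa using this
    · intro k hk
      have hk' : k - 1 < μ.card := by have := hk.1; have := hk.2; omega
      refine ⟨(T.1.symm ⟨k - 1, hk'⟩).1, (T.1.symm ⟨k - 1, hk'⟩).2, ?_⟩
      have := hk.1
      simp
      omega
  · intro c hc d hd h
    simp only [hc, hd, dite_true, add_lt_add_iff_right, Fin.val_fin_lt]
    rcases h with h | h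
    · exact T.2.1 ⟨c, hc⟩ ⟨d, hd⟩ h.1 h.2
    · exact T.2.2 ⟨c, hc⟩ ⟨d, hd⟩ h.1 h.2
  · intro T U h
    apply Subtype.ext
    apply Equiv.ext
    rintro ⟨c, hc⟩
    have := congrFun (congrArg Subtype.val h) c
    simp only [hc, dite_true, add_left_inj] at this
    exact Fin.ext this
  · rintro ⟨t, h0, h1, h2⟩
    have hb (c : μ.cells) : 1 ≤ t c ∧ t c ≤ μ.card := h1.mapsTo c.2
    let g : μ.cells → Fin μ.card := fun c => ⟨t c - 1, by have := hb c; omega⟩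
    have hg : Function.Bijective g := by
      constructor
      · intro c d hcd
        have h3 : t c - 1 = t d - 1 := congrArg Fin.val hcd
        have := hb c
        have := hb d
        exact Subtype.ext (h1.injOn c.2 d.2 (by omega))
      · intro k
        obtain ⟨c, hc, hk⟩ := h1.surjOn (show (k : ℕ) + 1 ∈ Set.Icc 1 μ.card from
          ⟨by omega, by have := k.2; omega⟩)
        exact ⟨⟨c, hc⟩, Fin.ext (by simp [g, hk])⟩
    have hlt (c d : μ.cells) (h : t c < t d) : g c < g d := by
      have := hb c
      have := hb d
      simp only [g, Fin.lt_def]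
      omega
    refine ⟨⟨Equiv.ofBijective g hg, fun c d h h' => ?_, fun c d h h' => ?_⟩, ?_⟩
    · exact hlt c d (h2 c c.2 d d.2 (.inl ⟨h, h'⟩))
    · exact hlt c d (h2 c c.2 d d.2 (.inr ⟨h, h'⟩))
    · apply Subtype.ext
      funext c
      by_cases hc : c ∈ μ.cells
      · have := hb ⟨c, hc⟩
        simp only at this
        simp [hc, g]
        omega
      · simp [hc, h0 c hc]

theorem dimension_eq_card_tableaux (μ : YoungDiagram) : dimension μ = Nat.card (tableaux μ) := by
  obtain ⟨F, hF⟩ := exists_bijective_tableaux μ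
  exact Nat.card_eq_of_bijective F hF

instance finite_tableaux (μ : YoungDiagram) : Finite (tableaux μ) := by
  obtain ⟨F, hF⟩ := exists_bijective_tableaux μ
  exact Finite.of_surjective F hF.2

theorem update_mem_tableaux {μ : YoungDiagram} {i : ℕ} (h : μ.rowLen (i + 1) < μ.rowLen i)
    {t : ℕ × ℕ → ℕ} (ht : t ∈ tableaux (eraseCorner μ i h)) :
    Function.update t (i, μ.rowLen i - 1) μ.card ∈ tableaux μ := by
  obtain ⟨h0, h1, h2⟩ := ht
  have hc := corner_mem h
  have hcard := card_eraseCorner h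
  rw [cells_eraseCorner] at h0 h1 h2
  set c := (i, μ.rowLen i - 1) with hcdef
  have hu (d) (hd : d ≠ c) : Function.update t c μ.card d = t d := Function.update_of_ne hd _ _
  refine ⟨fun d hd => ?_, ?_, fun d hd e he hde => ?_⟩
  · rw [hu d (by rintro rfl; exact hd hc)]
    exact h0 d (fun h => hd (mem_of_mem_erase h))
  · have h3 : Set.BijOn (Function.update t c μ.card) (μ.cells.erase c)
        (Set.Icc 1 (eraseCorner μ i h).card) := by
      refine h1.congr fun d hd => ?_
      exact (hu d (by simpa using ne_of_mem_erase hd)).symm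
    have h4 := h3.insert (a := c) (by
      simp only [Function.update_self, Set.mem_Icc]; omega)
    convert! h4 using 1
    · rw [← coe_insert, insert_erase hc]
    · ext k
      simp only [Set.mem_Icc, Function.update_self, Set.mem_insert_iff]
      omega
  · have hdc : d ≠ c := by
      rintro rfl
      obtain ⟨e1, e2⟩ := e
      rw [YoungDiagram.mem_cells, YoungDiagram.mem_iff_lt_rowLen] at he
      simp only [hcdef] at hde
      rcases hde with hde | hde
      · rw [← hde.1] at he
        omega
      · have := μ.rowLen_anti (i + 1) e1 (by omega)
        omega
    rw [hu d hdc]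
    have hd' : d ∈ μ.cells.erase c := mem_erase.2 ⟨hdc, hd⟩
    by_cases hec : e = c
    · subst hec
      rw [Function.update_self]
      have := (h1.mapsTo hd').2
      omega
    · rw [hu e hec]
      exact h2 d hd' e (mem_erase.2 ⟨hec, he⟩) hde

/-- The largest entry of a standard tableau sits in a corner, and deleting it leaves a standard
tableau. -/
theorem exists_update_eq {μ : YoungDiagram} (hμ : 0 < μ.card) {t : ℕ × ℕ → ℕ}
    (ht : t ∈ tableaux μ) :
    ∃ i, ∃ h : μ.rowLen (i + 1) < μ.rowLen i, ∃ s ∈ tableaux (eraseCorner μ i h),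
      Function.update s (i, μ.rowLen i - 1) μ.card = t := by
  obtain ⟨h0, h1, h2⟩ := ht
  obtain ⟨⟨i, j⟩, hc, hn⟩ := h1.surjOn (show μ.card ∈ Set.Icc 1 μ.card from ⟨hμ, le_rfl⟩)
  have hmax (d) (hd : d ∈ μ.cells) : ¬ t (i, j) < t d := by
    have := (h1.mapsTo hd).2
    omega
  have hj : j < μ.rowLen i := YoungDiagram.mem_iff_lt_rowLen.1 hc
  have hj1 : μ.rowLen i ≤ j + 1 := by
    by_contra! hlt
    have hd : (i, j + 1) ∈ μ.cells := YoungDiagram.mem_iff_lt_rowLen.2 hlt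
    exact hmax _ hd (h2 _ hc _ hd (by simp))
  have hj2 : μ.rowLen (i + 1) ≤ j := by
    by_contra! hlt
    have hd : (i + 1, j) ∈ μ.cells := YoungDiagram.mem_iff_lt_rowLen.2 hlt
    exact hmax _ hd (h2 _ hc _ hd (by simp))
  have hj3 : j = μ.rowLen i - 1 := by omega
  have h : μ.rowLen (i + 1) < μ.rowLen i := by omega
  have hcard := card_eraseCorner h
  rw [hj3] at hc hn
  refine ⟨i, h, Function.update t (i, μ.rowLen i - 1) 0, ?_, ?_⟩
  · unfold tableaux
    rw [cells_eraseCorner]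
    set c := (i, μ.rowLen i - 1) with hcdef
    have hu (d) (hd : d ≠ c) : Function.update t c 0 d = t d := Function.update_of_ne hd _ _
    refine ⟨fun d hd => ?_, ?_, fun d hd e he hde => ?_⟩
    · by_cases hdc : d = c
      · subst hdc; simp
      · rw [hu d hdc]
        exact h0 d (fun h => hd (mem_erase.2 ⟨hdc, h⟩))
    · have h3 := h1.sdiff_singleton hc
      rw [coe_erase]
      rw [hn] at h3
      have h4 : Set.Icc 1 μ.card \ {μ.card} = Set.Icc 1 (eraseCorner μ i h).card := by
        ext k
        simp only [Set.mem_Icc, Set.mem_sdiff, Set.mem_singleton_iff]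
        omega
      rw [h4] at h3
      exact h3.congr fun d hd => (hu d hd.2).symm
    · rw [hu d (ne_of_mem_erase hd), hu e (ne_of_mem_erase he)]
      exact h2 d (mem_of_mem_erase hd) e (mem_of_mem_erase he) hde
  · rw [Function.update_idem, ← hn, Function.update_eq_self]

/-- The branching rule: `f^μ` is the sum of the dimensions of the diagrams obtained from `μ` by
removing a corner. -/
theorem dimension_eq_sum (μ : YoungDiagram) (hμ : 0 < μ.card) {m : ℕ} (hm : μ.colLen 0 ≤ m) :
    dimension μ = ∑ i : Fin m, if h : μ.rowLen (i + 1) < μ.rowLen i then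
      dimension (eraseCorner μ i h) else 0 := by
  classical
  let ι := {i : Fin m // μ.rowLen (i + 1) < μ.rowLen i}
  let F : (Σ i : ι, tableaux (eraseCorner μ i.1 i.2)) → tableaux μ :=
    fun p => ⟨Function.update p.2.1 (p.1.1, μ.rowLen p.1.1 - 1) μ.card,
      update_mem_tableaux p.1.2 p.2.2⟩
  have hF : Function.Bijective F := by
    constructor
    · rintro ⟨⟨i, hi⟩, ⟨s, hs⟩⟩ ⟨⟨j, hj⟩, ⟨t, ht⟩⟩ hst
      have hval : Function.update s ((i : ℕ), μ.rowLen i - 1) μ.card =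
        Function.update t ((j : ℕ), μ.rowLen j - 1) μ.card := congrArg Subtype.val hst
      have hij : ((i : ℕ), μ.rowLen i - 1) = ((j : ℕ), μ.rowLen j - 1) := by
        refine (update_mem_tableaux hi hs).2.1.injOn (corner_mem hi) (corner_mem hj) ?_
        rw [Function.update_self]
        conv_rhs => rw [hval]
        rw [Function.update_self]
      obtain rfl : i = j := Fin.ext (congrArg Prod.fst hij)
      have : s = t := by
        funext d
        by_cases hd : d = ((i : ℕ), μ.rowLen i - 1)
        · subst hd
          rw [hs.1 _ (by simp [eraseCorner]), ht.1 _ (by simp [eraseCorner])]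
        · have := congrFun hval d
          rwa [Function.update_of_ne hd, Function.update_of_ne hd] at this
      subst this
      rfl
    · rintro ⟨t, ht⟩
      obtain ⟨i, h, s, hs, hst⟩ := exists_update_eq hμ ht
      have hi : i < m := lt_of_lt_of_le (rowLen_pos_iff.1 (by omega)) hm
      exact ⟨⟨⟨⟨i, hi⟩, h⟩, ⟨s, hs⟩⟩, Subtype.ext hst⟩
  rw [dimension_eq_card_tableaux, ← Nat.card_eq_of_bijective F hF, Nat.card_sigma,
    Finset.sum_dite, Finset.sum_const_zero, add_zero]
  simp only [← dimension_eq_card_tableaux]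
  refine Finset.sum_bij (fun i _ => ⟨i.1, by simpa using i.2⟩) ?_ ?_ ?_ ?_
  · simp
  · intro i _ j _ h
    exact Subtype.ext (by simpa using h)
  · rintro ⟨i, hi⟩ _
    exact ⟨⟨i, by simpa using hi⟩, by simp, rfl⟩
  · simp

theorem dimension_of_card_eq_zero {μ : YoungDiagram} (hμ : μ.card = 0) : dimension μ = 1 := by
  rw [dimension_eq_card_tableaux, Nat.card_eq_one_iff_unique]
  have hc : μ.cells = ∅ := Finset.card_eq_zero.1 hμ
  refine ⟨⟨fun s t => ?_⟩, ⟨⟨0, ?_⟩⟩⟩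
  · ext c
    rw [s.2.1 c (by simp [hc]), t.2.1 c (by simp [hc])]
  · simp [tableaux, hc, hμ]

/-! ### The determinantal formula for the dimension -/

/-- The difference product `∏_{i<j} (x i - x j)`. -/
def diffProd {m : ℕ} (x : Fin m → ℕ) : ℤ := ∏ i, ∏ j ∈ Ioi i, ((x i : ℤ) - x j)

/-- The falling factorials `(x)_0, (x)_1, …` are monic of degrees `0, 1, …`, so this determinant is a
Vandermonde determinant. -/
theorem det_descFactorial_eq {m : ℕ} (x : Fin m → ℕ) :
    (Matrix.of fun i j : Fin m => ((x i).descFactorial j : ℤ)).det =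
      (∏ i : Fin m, ∏ _j ∈ Ioi i, (-1 : ℤ)) * diffProd x := by
  have h := Matrix.det_eval_matrixOfPolynomials_eq_det_vandermonde (fun i => (x i : ℤ))
    (fun i : Fin m => descPochhammer ℤ i) (fun i => descPochhammer_natDegree ℤ i)
    (fun i => monic_descPochhammer ℤ i)
  simp only [descPochhammer_eval_eq_descFactorial] at h
  rw [← h, Matrix.det_vandermonde, diffProd, ← Finset.prod_mul_distrib]
  refine Finset.prod_congr rfl fun i _ => ?_
  rw [← Finset.prod_mul_distrib]
  exact Finset.prod_congr rfl fun j _ => by ring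

theorem mul_pred_descFactorial (x k : ℕ) :
    (x : ℤ) * ((x - 1).descFactorial k : ℤ) = (x - k) * (x.descFactorial k : ℤ) := by
  rcases x with _ | x
  · rcases k with _ | k <;> simp
  · have h := Nat.succ_descFactorial x k
    rcases le_or_gt k (x + 1) with hk | hk
    · rw [← Nat.cast_sub hk]
      exact_mod_cast h.symm
    · rw [Nat.descFactorial_eq_zero_iff_lt.2 hk,
        Nat.descFactorial_eq_zero_iff_lt.2 (show x + 1 - 1 < k by omega)]
      simp

/-- In the basis of falling factorials the operator `f ↦ x f(x - 1)` is `(x)_k ↦ (x - k) (x)_k`.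
Applying it to one row at a time and expanding by the Leibniz formula, every permutation
contributes the same factor `∑ x i - ∑ i`. -/
theorem sum_mul_det_update {m : ℕ} (x : Fin m → ℕ) :
    ∑ i, (x i : ℤ) * (Matrix.of fun k j : Fin m =>
        ((Function.update x i (x i - 1) k).descFactorial j : ℤ)).det =
      (∑ i, (x i : ℤ) - ∑ i : Fin m, (i : ℤ)) *
        (Matrix.of fun i j : Fin m => ((x i).descFactorial j : ℤ)).det := by
  have hrow (i : Fin m) (σ : Equiv.Perm (Fin m)) :
      (x i : ℤ) * ∏ k, ((Function.update x i (x i - 1) k).descFactorial (σ k) : ℤ) =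
        (x i - (σ i : ℕ)) * ∏ k, ((x k).descFactorial (σ k) : ℤ) := by
    rw [← Finset.mul_prod_erase _ _ (mem_univ i), ← Finset.mul_prod_erase _ _ (mem_univ i),
      ← mul_assoc, ← mul_assoc, Function.update_self, mul_pred_descFactorial]
    congr 1
    refine Finset.prod_congr rfl fun k hk => ?_
    rw [Function.update_of_ne (ne_of_mem_erase hk)]
  have hdet (y : Fin m → ℕ) : (Matrix.of fun k j : Fin m => ((y k).descFactorial j : ℤ)).det =
      ∑ σ : Equiv.Perm (Fin m), (Equiv.Perm.sign σ : ℤ) *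
        ∏ k, ((y k).descFactorial (σ k) : ℤ) := by
    rw [← Matrix.det_transpose, Matrix.det_apply']
    rfl
  simp only [hdet, Finset.mul_sum]
  rw [Finset.sum_comm]
  refine Finset.sum_congr rfl fun σ _ => ?_
  have (i : Fin m) := mul_left_comm (x i : ℤ) (Equiv.Perm.sign σ : ℤ)
    (∏ k, ((Function.update x i (x i - 1) k).descFactorial (σ k) : ℤ))
  simp only [this, hrow]
  rw [← Finset.mul_sum, ← Finset.sum_mul, Finset.sum_sub_distrib,
    Equiv.sum_comp σ (fun i => ((i : ℕ) : ℤ))]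
  ring

/-- Replacing `x i` by `x i - 1` truncates at `x i = 0`, where the coefficient `x i` vanishes. -/
theorem sum_mul_diffProd_update {m : ℕ} (x : Fin m → ℕ) :
    ∑ i, (x i : ℤ) * diffProd (Function.update x i (x i - 1)) =
      (∑ i, (x i : ℤ) - ∑ i : Fin m, (i : ℤ)) * diffProd x := by
  have h := sum_mul_det_update x
  simp only [det_descFactorial_eq] at h
  have hs : (∏ i : Fin m, ∏ _j ∈ Ioi i, (-1 : ℤ)) ≠ 0 := by
    simp [Finset.prod_ne_zero_iff]
  apply mul_left_cancel₀ hs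
  rw [Finset.mul_sum, mul_left_comm, ← h]
  exact Finset.sum_congr rfl fun i _ => by ring

/-- The beta numbers of `μ` for `m` rows: `x i = μ_i + (m - 1 - i)` for `i < m`. They are strictly
decreasing in `i`. -/
def beta (m : ℕ) (μ : YoungDiagram) (i : ℕ) : ℕ := μ.rowLen i + (m - 1 - i)

theorem beta_strictAnti {m : ℕ} (μ : YoungDiagram) {i j : ℕ} (hij : i < j) (hj : j < m) :
    beta m μ j < beta m μ i := by
  have := μ.rowLen_anti i j hij.le
  unfold beta
  omega

theorem beta_injOn (m : ℕ) (μ : YoungDiagram) : Set.InjOn (beta m μ) (range m) := by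
  intro i hi j hj h
  simp only [coe_range, Set.mem_Iio] at hi hj
  rcases lt_trichotomy i j with hij | hij | hij
  · have := beta_strictAnti μ hij hj
    omega
  · exact hij
  · have := beta_strictAnti μ hij hi
    omega

theorem sum_beta {m : ℕ} (μ : YoungDiagram) (hm : μ.colLen 0 ≤ m) :
    ∑ i ∈ range m, beta m μ i = μ.card + ∑ i ∈ range m, i := by
  unfold beta
  rw [Finset.sum_add_distrib, ← card_eq_sum_rowLen μ hm, Finset.sum_range_reflect (fun i => i)]

theorem diffProd_eq_zero {m : ℕ} {x : Fin m → ℕ} {i j : Fin m} (hij : i < j) (h : x i = x j) :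
    diffProd x = 0 :=
  Finset.prod_eq_zero (mem_univ i) (Finset.prod_eq_zero (mem_Ioi.2 hij) (by simp [h]))

theorem diffProd_staircase (m : ℕ) :
    diffProd (fun i : Fin m => m - 1 - i) = ∏ i : Fin m, ((m - 1 - i : ℕ).factorial : ℤ) := by
  unfold diffProd
  refine Finset.prod_congr rfl fun i _ => ?_
  have h1 : ∀ j ∈ Ioi i, (((m - 1 - i : ℕ) : ℤ) - ((m - 1 - j : ℕ) : ℤ)) =
      (((j : ℕ) - (i : ℕ) : ℕ) : ℤ) := by
    intro j hj
    have := Fin.lt_def.1 (mem_Ioi.1 hj)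
    have := j.2
    omega
  rw [Finset.prod_congr rfl h1, ← Nat.cast_prod, ← Finset.prod_range_add_one_eq_factorial]
  congr 1
  refine Finset.prod_bij (fun j _ => (j : ℕ) - i - 1) ?_ ?_ ?_ ?_
  · intro j hj
    have := Fin.lt_def.1 (mem_Ioi.1 hj)
    have := j.2
    simp only [mem_range]
    omega
  · intro j hj k hk h
    have := Fin.lt_def.1 (mem_Ioi.1 hj)
    have := Fin.lt_def.1 (mem_Ioi.1 hk)
    exact Fin.ext (by omega)
  · intro k hk
    rw [mem_range] at hk
    have := i.2
    refine ⟨⟨i + k + 1, by omega⟩, mem_Ioi.2 (Fin.lt_def.2 (by simp only; omega)), ?_⟩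
    simp only
    omega
  · intro j hj
    have := Fin.lt_def.1 (mem_Ioi.1 hj)
    omega

/-- Frobenius' formula `f^μ ∏ x_i! = |μ|! ∏_{i<j} (x_i - x_j)` in terms of beta numbers: both sides
satisfy the branching rule. -/
theorem dimension_mul_prod_factorial (m : ℕ) (μ : YoungDiagram) (hm : μ.colLen 0 ≤ m) :
    (dimension μ : ℤ) * ∏ i : Fin m, ((beta m μ i).factorial : ℤ) =
      (μ.card.factorial : ℤ) * diffProd (fun i : Fin m => beta m μ i) := by
  induction hn : μ.card generalizing μ with
  | zero =>
    have h0 (i : ℕ) : μ.rowLen i = 0 := by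
      have hc : μ.cells = ∅ := Finset.card_eq_zero.1 hn
      by_contra h
      have : (i, 0) ∈ μ.cells := YoungDiagram.mem_iff_lt_rowLen.2 (Nat.pos_of_ne_zero h)
      simp [hc] at this
    have hb : beta m μ = fun i => m - 1 - i := by
      funext i
      simp [beta, h0]
    rw [dimension_of_card_eq_zero hn, hb, diffProd_staircase]
    simp
  | succ n ih =>
    have hsum : ∑ i : Fin m, (beta m μ i : ℤ) - ∑ i : Fin m, ((i : ℕ) : ℤ) = (n + 1 : ℕ) := by
      have := sum_beta μ hm
      rw [Fin.sum_univ_eq_sum_range (fun i => (beta m μ i : ℤ)),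
        Fin.sum_univ_eq_sum_range (fun i => (i : ℤ)), ← Nat.cast_sum, ← Nat.cast_sum, this, hn]
      push_cast
      ring
    rw [Nat.factorial_succ, mul_comm (n + 1), Nat.cast_mul, mul_assoc, ← hsum,
      ← sum_mul_diffProd_update, dimension_eq_sum μ (by omega) hm, Nat.cast_sum,
      Finset.sum_mul, Finset.mul_sum]
    refine Finset.sum_congr rfl fun i _ => ?_
    have hi := i.2
    split_ifs with h
    · have hcol := (colLen_eraseCorner_le h).trans hm
      have hcard := card_eraseCorner h
      have hx : (fun k : Fin m => beta m (eraseCorner μ i h) k) =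
          Function.update (fun k : Fin m => beta m μ k) i (beta m μ i - 1) := by
        funext k
        by_cases hk : k = i
        · subst hk
          simp only [beta, rowLen_eraseCorner, Function.update_self, if_true]
          omega
        · rw [Function.update_of_ne hk]
          simp [beta, rowLen_eraseCorner, Fin.val_inj, hk]
      have key := ih _ hcol (by omega)
      rw [hx] at key
      rw [mul_left_comm, ← key, mul_left_comm]
      congr 1
      rw [← Finset.mul_prod_erase _ _ (mem_univ i), ← Finset.mul_prod_erase univ
        (fun k : Fin m => ((beta m (eraseCorner μ i h) k).factorial : ℤ)) (mem_univ i), ← mul_assoc]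
      have hxi := congrFun hx i
      simp only [Function.update_self] at hxi
      congr 1
      · rw [hxi, ← Nat.cast_mul, Nat.mul_factorial_pred]
        unfold beta
        omega
      · refine Finset.prod_congr rfl fun k hk => ?_
        have := congrFun hx k
        rw [Function.update_of_ne (ne_of_mem_erase hk)] at this
        rw [this]
    · -- Row `i` does not end in a corner: either `x_i - 1` is the next beta number, or `x_i = 0`.
      rw [Nat.cast_zero, zero_mul]
      have hlen := μ.rowLen_anti i (i + 1) (by omega)
      by_cases hi1 : (i : ℕ) + 1 < m
      · rw [diffProd_eq_zero (i := i) (j := ⟨i + 1, hi1⟩) (Fin.lt_def.2 (by simp)), mul_zero,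
          mul_zero]
        rw [Function.update_self, Function.update_of_ne (by simp [Fin.ext_iff])]
        simp only [beta]
        omega
      · have h1 := rowLen_eq_zero_iff.2 (hm.trans (show m ≤ (i : ℕ) + 1 by omega))
        have : beta m μ i = 0 := by
          unfold beta
          omega
        simp [this]

/-! ### The 2-adic valuation of Frobenius' formula -/

/-- The set of beta numbers of `μ` for `m` rows. -/
def betaSet (m : ℕ) (μ : YoungDiagram) : Finset ℕ := (range m).image (beta m μ)

/-- The 2-adic valuation of `∏ (x - y)` over the pairs `y < x` in `X`. -/
def valDiff (X : Finset ℕ) : ℕ := ∑ x ∈ X, ∑ y ∈ X with y < x, padicValNat 2 (x - y)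

/-- The 2-adic valuation of `∏ x!` over `X`. -/
def valFact (X : Finset ℕ) : ℕ := ∑ x ∈ X, padicValNat 2 x.factorial

theorem padicValNat_finset_prod {ι : Type*} {s : Finset ι} {f : ι → ℕ} (h : ∀ i ∈ s, f i ≠ 0) :
    padicValNat 2 (∏ i ∈ s, f i) = ∑ i ∈ s, padicValNat 2 (f i) := by
  simp only [← Nat.factorization_def _ Nat.prime_two]
  rw [Nat.factorization_prod h, Finsupp.coe_finsetSum, Finset.sum_apply]

theorem sum_fin_eq_sum_betaSet (m : ℕ) (μ : YoungDiagram) (g : ℕ → ℕ) :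
    ∑ i : Fin m, g (beta m μ i) = ∑ x ∈ betaSet m μ, g x := by
  rw [Fin.sum_univ_eq_sum_range (fun i => g (beta m μ i)), betaSet,
    Finset.sum_image (beta_injOn m μ)]

/-- The beta numbers below `x_i` are those of the rows below row `i`. -/
theorem filter_lt_betaSet {m : ℕ} (μ : YoungDiagram) (i : Fin m) :
    {y ∈ betaSet m μ | y < beta m μ i} = (Ioi i).image fun j : Fin m => beta m μ j := by
  ext y
  simp only [betaSet, mem_filter, mem_image, mem_range, mem_Ioi]
  constructor
  · rintro ⟨⟨j, hj, rfl⟩, h⟩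
    refine ⟨⟨j, hj⟩, ?_, rfl⟩
    by_contra hij
    rcases (not_lt.1 hij).eq_or_lt with h1 | h1
    · rw [← h1] at h; exact absurd h (lt_irrefl _)
    · exact absurd h (beta_strictAnti μ (Fin.lt_def.1 h1) i.2).not_gt
  · rintro ⟨j, hij, rfl⟩
    exact ⟨⟨j, j.2, rfl⟩, beta_strictAnti μ (Fin.lt_def.1 hij) j.2⟩

/-- The 2-adic valuation of `dimension_mul_prod_factorial`. -/
theorem valuation_frobenius {m : ℕ} (μ : YoungDiagram) (hm : μ.colLen 0 ≤ m) :
    padicValNat 2 (dimension μ) + valFact (betaSet m μ) =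
      padicValNat 2 μ.card.factorial + valDiff (betaSet m μ) := by
  have hsub (i : Fin m) (j) (hj : j ∈ Ioi i) : beta m μ i - beta m μ j ≠ 0 := by
    have := beta_strictAnti μ (Fin.lt_def.1 (mem_Ioi.1 hj)) j.2
    omega
  have h : dimension μ * ∏ i : Fin m, (beta m μ i).factorial =
      μ.card.factorial * ∏ i : Fin m, ∏ j ∈ Ioi i, (beta m μ i - beta m μ j) := by
    have := dimension_mul_prod_factorial m μ hm
    zify
    rw [this, diffProd]
    congr 1
    refine Finset.prod_congr rfl fun i _ => Finset.prod_congr rfl fun j hj => ?_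
    rw [Nat.cast_sub]
    have := hsub i j hj
    omega
  have hD : ∏ i : Fin m, ∏ j ∈ Ioi i, (beta m μ i - beta m μ j) ≠ 0 :=
    Finset.prod_ne_zero_iff.2 fun i _ => Finset.prod_ne_zero_iff.2 fun j hj => hsub i j hj
  have hF : ∏ i : Fin m, (beta m μ i).factorial ≠ 0 :=
    Finset.prod_ne_zero_iff.2 fun i _ => Nat.factorial_ne_zero _
  have hdim : dimension μ ≠ 0 := by
    intro h0
    rw [h0, zero_mul] at h
    exact mul_ne_zero (Nat.factorial_ne_zero _) hD h.symm
  have hv := congrArg (padicValNat 2) h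
  rw [padicValNat.mul hdim hF, padicValNat.mul (Nat.factorial_ne_zero _) hD,
    padicValNat_finset_prod (fun i _ => Nat.factorial_ne_zero _),
    padicValNat_finset_prod (fun i _ => Finset.prod_ne_zero_iff.2 fun j hj => hsub i j hj)] at hv
  rw [valFact, ← sum_fin_eq_sum_betaSet m μ (fun x => padicValNat 2 x.factorial), hv, valDiff,
    ← sum_fin_eq_sum_betaSet m μ
      (fun x => ∑ y ∈ betaSet m μ with y < x, padicValNat 2 (x - y))]
  congr 1
  refine Finset.sum_congr rfl fun i _ => ?_
  rw [padicValNat_finset_prod (hsub i), filter_lt_betaSet, Finset.sum_image]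
  intro j _ k _ hjk
  exact Fin.ext (beta_injOn m μ (by simp) (by simp) hjk)

theorem card_betaSet (m : ℕ) (μ : YoungDiagram) : (betaSet m μ).card = m := by
  rw [betaSet, Finset.card_image_of_injOn (beta_injOn m μ), card_range]

theorem sum_betaSet {m : ℕ} (μ : YoungDiagram) (hm : μ.colLen 0 ≤ m) :
    ∑ x ∈ betaSet m μ, x = μ.card + ∑ i ∈ range m, i := by
  rw [betaSet, Finset.sum_image (beta_injOn m μ), sum_beta μ hm]

/-! ### Splitting a set of beta numbers by parity -/

/-- The set of all `a` with `2 a + r ∈ X`, for a residue `r < 2`. -/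
def half (r : ℕ) (X : Finset ℕ) : Finset ℕ := {x ∈ X | x % 2 = r}.image (· / 2)

theorem half_injOn (r : ℕ) (X : Finset ℕ) :
    Set.InjOn (· / 2) ({x ∈ X | x % 2 = r} : Finset ℕ) := by
  intro x hx y hy h
  simp only [coe_filter, Set.mem_ofPred_eq] at hx hy h
  omega

theorem sum_half (r : ℕ) (X : Finset ℕ) (g : ℕ → ℕ) :
    ∑ a ∈ half r X, g a = ∑ x ∈ X with x % 2 = r, g (x / 2) := by
  rw [half, Finset.sum_image (half_injOn r X)]

theorem sum_eq_sum_parity (X : Finset ℕ) (g : ℕ → ℕ) :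
    ∑ x ∈ X, g x = ∑ r ∈ range 2, ∑ x ∈ X with x % 2 = r, g x := by
  rw [Finset.sum_fiberwise_of_maps_to]
  intro x _
  rw [mem_range]
  omega

theorem valFact_eq (X : Finset ℕ) :
    valFact X = ∑ r ∈ range 2, (∑ a ∈ half r X, a + valFact (half r X)) := by
  rw [valFact, sum_eq_sum_parity]
  refine Finset.sum_congr rfl fun r hr => ?_
  rw [valFact, sum_half, sum_half r X (fun a => padicValNat 2 a.factorial),
    ← Finset.sum_add_distrib]
  refine Finset.sum_congr rfl fun x _ => ?_
  conv_lhs => rw [← Nat.div_add_mod x 2]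
  rw [padicValNat_factorial_mul_add _ (Nat.mod_lt x two_pos), padicValNat_factorial_mul, add_comm]

theorem sum_card_lt (A : Finset ℕ) :
    ∑ a ∈ A, #{b ∈ A | b < a} = ∑ i ∈ range #A, i := by
  induction A using Finset.induction_on_max with
  | empty => simp
  | insert a A ha ih =>
    have hn : a ∉ A := fun h => lt_irrefl _ (ha a h)
    rw [Finset.sum_insert hn, Finset.card_insert_of_notMem hn, Finset.sum_range_succ, ← ih, add_comm]
    congr 1
    · refine Finset.sum_congr rfl fun b hb => ?_
      rw [Finset.filter_insert, if_neg (ha b hb).not_gt]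
    · rw [Finset.filter_insert, if_neg (lt_irrefl a), Finset.filter_true_of_mem ha]

theorem valDiff_eq (X : Finset ℕ) :
    valDiff X = ∑ r ∈ range 2, (∑ i ∈ range #(half r X), i + valDiff (half r X)) := by
  rw [valDiff, sum_eq_sum_parity]
  refine Finset.sum_congr rfl fun r hr => ?_
  rw [← sum_card_lt, valDiff, ← Finset.sum_add_distrib,
    sum_half r X (fun a => #{b ∈ half r X | b < a} +
      ∑ y ∈ half r X with y < a, padicValNat 2 (a - y))]
  refine Finset.sum_congr rfl fun x hx => ?_
  rw [mem_filter] at hx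
  rw [Finset.card_eq_sum_ones, ← Finset.sum_add_distrib, Finset.sum_filter (fun y => y < x / 2),
    sum_half r X (fun y => if y < x / 2 then 1 + padicValNat 2 (x / 2 - y) else 0),
    Finset.sum_filter, Finset.sum_filter]
  refine Finset.sum_congr rfl fun y _ => ?_
  by_cases hy : y % 2 = r
  · rw [if_pos hy]
    by_cases hlt : y < x
    · rw [if_pos hlt, if_pos (by omega), show x - y = 2 * (x / 2 - y / 2) by omega,
        padicValNat.mul (by norm_num) (by omega), padicValNat_self]
    · rw [if_neg hlt, if_neg (by omega)]
  · rw [if_neg hy]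
    split_ifs
    · exact padicValNat.eq_zero_of_not_dvd (by omega)
    · rfl

/-! ### The beta numbers of the 2-quotient -/

/-- Going along the boundary of `μ` from the lower left, the beta numbers of the rows below row `i`
and the numbers `j + m - μ'_j` of the columns meeting row `i` exhaust the numbers below `x_i`. -/
theorem range_beta_eq {m : ℕ} (μ : YoungDiagram) (hm : μ.colLen 0 ≤ m) {i : ℕ} (hi : i < m) :
    (Ioo i m).image (beta m μ) ∪ (range (μ.rowLen i)).image (fun j => j + m - μ.colLen j) =
      range (beta m μ i) ∧
    Disjoint ((Ioo i m).image (beta m μ))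
      ((range (μ.rowLen i)).image (fun j => j + m - μ.colLen j)) ∧
    Set.InjOn (fun j => j + m - μ.colLen j) (range (μ.rowLen i)) := by
  have hcol (j) : μ.colLen j ≤ m := (μ.colLen_anti 0 j (Nat.zero_le _)).trans hm
  have hanti (j k) (h : j ≤ k) := μ.colLen_anti j k h
  have hinj : Set.InjOn (fun j => j + m - μ.colLen j) (range (μ.rowLen i)) := by
    intro j _ k _ h
    simp only at h
    have := hcol j
    have := hcol k
    rcases le_total j k with hjk | hjk <;> have := hanti _ _ hjk <;> omega
  have hdisj : Disjoint ((Ioo i m).image (beta m μ))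
      ((range (μ.rowLen i)).image (fun j => j + m - μ.colLen j)) := by
    rw [Finset.disjoint_left]
    intro y h1 h2
    obtain ⟨k, hk, rfl⟩ := mem_image.1 h1
    obtain ⟨j, hj, h⟩ := mem_image.1 h2
    rw [mem_Ioo] at hk
    have := hcol j
    unfold beta at h
    have hiff : j < μ.rowLen k ↔ k < μ.colLen j := by
      rw [← YoungDiagram.mem_iff_lt_rowLen, YoungDiagram.mem_iff_lt_colLen]
    by_cases hj' : j < μ.rowLen k
    · have := hiff.1 hj'
      omega
    · have := mt hiff.2 hj'
      omega
  refine ⟨?_, hdisj, hinj⟩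
  refine Finset.eq_of_subset_of_card_le ?_ ?_
  · intro y hy
    rw [mem_range]
    rcases mem_union.1 hy with h | h
    · obtain ⟨k, hk, rfl⟩ := mem_image.1 h
      rw [mem_Ioo] at hk
      exact beta_strictAnti μ hk.1 hk.2
    · obtain ⟨j, hj, rfl⟩ := mem_image.1 h
      rw [mem_range] at hj
      have : i < μ.colLen j := by
        rwa [← YoungDiagram.mem_iff_lt_colLen, YoungDiagram.mem_iff_lt_rowLen]
      have := hcol j
      simp only [beta]
      omega
  · rw [Finset.card_union_of_disjoint hdisj, Finset.card_image_of_injOn hinj,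
      Finset.card_image_of_injOn ((beta_injOn m μ).mono _), card_range, card_range, Nat.card_Ioo,
      beta]
    · omega
    · intro k hk
      simp only [coe_Ioo, Set.mem_Ioo, coe_range, Set.mem_Iio] at hk ⊢
      exact hk.2

theorem card_filter_mod_two (x r : ℕ) (hr : r < 2) :
    #{y ∈ range x | y % 2 = r} = (x + 1 - r) / 2 := by
  induction x with
  | zero => simp; omega
  | succ x ih =>
    rw [Finset.range_add_one, Finset.filter_insert]
    split_ifs with h
    · rw [Finset.card_insert_of_notMem (by simp), ih]
      omega
    · rw [ih]
      omega

/-- The parity of the beta numbers of the rows ending in label `ε`, for `m` rows. -/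
def parity (m : ℕ) (ε : Bool) : ℕ := (ε.toNat + m) % 2

theorem bodd_eq_iff (k : ℕ) (ε : Bool) : k.bodd = ε ↔ k % 2 = ε.toNat := by
  rw [Nat.mod_two_of_bodd]
  cases k.bodd <;> cases ε <;> simp

theorem rowEnd_eq_iff {μ : YoungDiagram} {i : ℕ} (hi : i < μ.colLen 0) (ε : Bool) :
    rowEnd μ i = ε ↔ beta (μ.colLen 0) μ i % 2 = parity (μ.colLen 0) ε := by
  have := rowLen_pos_iff.2 hi
  have := Bool.toNat_le ε
  rw [rowEnd, label, bodd_eq_iff, beta, parity]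
  omega

theorem colEnd_eq_iff {μ : YoungDiagram} {j : ℕ} (hj : 0 < μ.colLen j) (ε : Bool) :
    colEnd μ j = !ε ↔ (j + μ.colLen 0 - μ.colLen j) % 2 = parity (μ.colLen 0) ε := by
  have := μ.colLen_anti 0 j (Nat.zero_le _)
  rw [colEnd, label, bodd_eq_iff, parity]
  cases ε <;> simp <;> omega

/-- Among the numbers below `x_i`, there are `x_i / 2` of the parity of `x_i`. By `range_beta_eq` they
come from the columns counted by `quotientRowLen` and from the rows below row `i` with the same end
label. -/
theorem quotientRowLen_add_card {μ : YoungDiagram} {i : ℕ} (hi : i < μ.colLen 0) {ε : Bool}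
    (hε : rowEnd μ i = ε) :
    quotientRowLen ε μ i + #{k ∈ Ioo i (μ.colLen 0) | rowEnd μ k = ε} =
      beta (μ.colLen 0) μ i / 2 := by
  obtain ⟨h1, h2, h3⟩ := range_beta_eq μ le_rfl hi
  set m := μ.colLen 0
  have hpar : beta m μ i % 2 = parity m ε := (rowEnd_eq_iff hi ε).1 hε
  have hc := card_filter_mod_two (beta m μ i) (parity m ε) (Nat.mod_lt _ two_pos)
  rw [← h1, Finset.filter_union, Finset.card_union_of_disjoint
    (Finset.disjoint_filter_filter h2), Finset.filter_image, Finset.filter_image,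
    Finset.card_image_of_injOn, Finset.card_image_of_injOn] at hc
  · have e1 : {k ∈ Ioo i m | beta m μ k % 2 = parity m ε} = {k ∈ Ioo i m | rowEnd μ k = ε} :=
      Finset.filter_congr fun k hk => (rowEnd_eq_iff (mem_Ioo.1 hk).2 ε).symm
    have e2 : {j ∈ range (μ.rowLen i) | (j + m - μ.colLen j) % 2 = parity m ε} =
        {j ∈ range (μ.rowLen i) | colEnd μ j = !ε} := by
      refine Finset.filter_congr fun j hj => (colEnd_eq_iff ?_ ε).symm
      have : i < μ.colLen j := by
        rwa [← YoungDiagram.mem_iff_lt_colLen, YoungDiagram.mem_iff_lt_rowLen, ← mem_range]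
      omega
    rw [e1, e2] at hc
    rw [quotientRowLen, add_comm, hc]
    omega
  · exact h3.mono (coe_subset.2 (Finset.filter_subset _ _))
  · refine (beta_injOn m μ).mono fun k hk => ?_
    simp only [coe_filter, mem_Ioo, Set.mem_ofPred_eq] at hk
    simpa using hk.1.2

/-- The rows of `μ` ending in label `ε`, in increasing order. -/
def rowList (ε : Bool) (μ : YoungDiagram) : List ℕ :=
  (List.range (μ.colLen 0)).filter fun i => rowEnd μ i = ε

theorem mem_rowList {ε : Bool} {μ : YoungDiagram} {i : ℕ} :
    i ∈ rowList ε μ ↔ i < μ.colLen 0 ∧ rowEnd μ i = ε := by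
  simp [rowList]

theorem rowList_strictMono (ε : Bool) (μ : YoungDiagram) : StrictMono (rowList ε μ).get :=
  (List.pairwise_lt_range.filter _).sortedLT.strictMono_get

theorem card_filter_Ioo_rowList (ε : Bool) (μ : YoungDiagram) (k : Fin (rowList ε μ).length) :
    #{i ∈ Ioo ((rowList ε μ).get k) (μ.colLen 0) | rowEnd μ i = ε} =
      (rowList ε μ).length - 1 - k := by
  have hmono := rowList_strictMono ε μ
  have : {i ∈ Ioo ((rowList ε μ).get k) (μ.colLen 0) | rowEnd μ i = ε} =
      (Ioi k).image (rowList ε μ).get := by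
    ext i
    simp only [mem_filter, mem_Ioo, mem_image, mem_Ioi]
    constructor
    · rintro ⟨⟨h1, h2⟩, h3⟩
      obtain ⟨l, rfl⟩ := List.get_of_mem (mem_rowList.2 ⟨h2, h3⟩)
      exact ⟨l, hmono.lt_iff_lt.1 h1, rfl⟩
    · rintro ⟨l, hl, rfl⟩
      have := mem_rowList.1 (List.get_mem (rowList ε μ) l)
      exact ⟨⟨hmono hl, this.1⟩, this.2⟩
  rw [this, Finset.card_image_of_injective _ hmono.injective, Fin.card_Ioi]

theorem rowLen_quotient (ε : Bool) (μ : YoungDiagram) (k : Fin (rowList ε μ).length) :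
    (quotient ε μ).rowLen k = quotientRowLen ε μ ((rowList ε μ).get k) := by
  have hlen : (quotientRowLens ε μ).length = (rowList ε μ).length := List.length_map _
  have := YoungDiagram.rowLen_ofRowLens (hw := quotientRowLens_sortedGE ε μ)
    ⟨k, by rw [hlen]; exact k.2⟩
  rw [quotient, this]
  simp only [quotientRowLens, Fin.getElem_fin, List.getElem_map]
  rfl

theorem colLen_quotient_le (ε : Bool) (μ : YoungDiagram) :
    (quotient ε μ).colLen 0 ≤ (rowList ε μ).length := by
  have hlen : (quotientRowLens ε μ).length = (rowList ε μ).length := List.length_map _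
  rw [← not_lt, ← YoungDiagram.mem_iff_lt_colLen, quotient, YoungDiagram.mem_ofRowLens]
  rintro ⟨h, _⟩
  exact absurd h (by simp [hlen])

/-- The beta numbers of the component `μ^(ε)` of the 2-quotient are the halves of the beta numbers
of `μ` of one parity. -/
theorem betaSet_quotient (ε : Bool) (μ : YoungDiagram) :
    betaSet (rowList ε μ).length (quotient ε μ) =
      half (parity (μ.colLen 0) ε) (betaSet (μ.colLen 0) μ) := by
  have hb (k : Fin (rowList ε μ).length) : beta (rowList ε μ).length (quotient ε μ) k =
      beta (μ.colLen 0) μ ((rowList ε μ).get k) / 2 := by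
    have h := mem_rowList.1 (List.get_mem (rowList ε μ) k)
    rw [← quotientRowLen_add_card h.1 h.2, card_filter_Ioo_rowList, beta, rowLen_quotient]
  ext a
  simp only [betaSet, half, mem_image, mem_filter, mem_range]
  constructor
  · rintro ⟨k, hk, rfl⟩
    have h := mem_rowList.1 (List.get_mem (rowList ε μ) ⟨k, hk⟩)
    exact ⟨_, ⟨⟨_, h.1, rfl⟩, (rowEnd_eq_iff h.1 ε).1 h.2⟩, (hb ⟨k, hk⟩).symm⟩
  · rintro ⟨_, ⟨⟨i, hi, rfl⟩, hp⟩, rfl⟩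
    obtain ⟨k, rfl⟩ := List.get_of_mem (mem_rowList.2 ⟨hi, (rowEnd_eq_iff hi ε).2 hp⟩)
    exact ⟨k, k.2, hb k⟩

theorem sum_parity (m : ℕ) (g : ℕ → ℕ) :
    ∑ r ∈ range 2, g r = g (parity m false) + g (parity m true) := by
  rw [Finset.sum_range_succ, Finset.sum_range_one]
  rcases Nat.mod_two_eq_zero_or_one m with h | h
  · rw [show parity m false = 0 by simp [parity]; omega,
      show parity m true = 1 by simp [parity]; omega]
  · rw [show parity m false = 1 by simp [parity]; omega,
      show parity m true = 0 by simp [parity]; omega, add_comm]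

/-! ### The size of the 2-core -/

/-- The number of cells of `μ` labelled `0` minus the number of cells labelled `1`. -/
def content (μ : YoungDiagram) : ℤ := ∑ c ∈ μ.cells, (-1) ^ (c.1 + c.2)

theorem RemovesDomino.content_eq {μ ν : YoungDiagram} (h : RemovesDomino μ ν) :
    content ν = content μ := by
  obtain ⟨i, j, ⟨h1, h2, h3⟩ | ⟨h1, h2, h3⟩⟩ := h <;>
  · rw [content, content, h3, ← Finset.sum_sdiff (Finset.insert_subset_iff.2
      ⟨(YoungDiagram.mem_cells _).2 h1,
        Finset.singleton_subset_iff.2 ((YoungDiagram.mem_cells _).2 h2)⟩),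
      Finset.sum_pair (by simp)]
    ring

theorem two_mul_sum_neg_one_pow (i l : ℕ) :
    2 * ∑ j ∈ range l, (-1 : ℤ) ^ (i + j) = (-1) ^ i - (-1) ^ (i + l) := by
  induction l with
  | zero => simp
  | succ l ih =>
    rw [Finset.sum_range_succ, mul_add, ih]
    ring

theorem length_rowList (ε : Bool) (μ : YoungDiagram) :
    (rowList ε μ).length = #{i ∈ range (μ.colLen 0) | rowEnd μ i = ε} := by
  rw [← card_betaSet (rowList ε μ).length (quotient ε μ), betaSet_quotient, half,
    Finset.card_image_of_injOn (half_injOn _ _), betaSet, Finset.filter_image,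
    Finset.card_image_of_injOn ((beta_injOn _ _).mono (coe_subset.2 (Finset.filter_subset _ _)))]
  congr 1
  exact Finset.filter_congr fun i hi => (rowEnd_eq_iff (mem_range.1 hi) ε).symm

theorem length_rowList_add (μ : YoungDiagram) :
    (rowList false μ).length + (rowList true μ).length = μ.colLen 0 := by
  have h := Finset.card_filter_add_card_filter_not (s := range (μ.colLen 0))
    (fun i => rowEnd μ i = false)
  simp only [Bool.not_eq_false, card_range] at h
  rw [length_rowList, length_rowList, h]

/-- The labels alternate along a row, so `content μ` is determined by the first and last
labels of the rows. -/
theorem two_mul_content (μ : YoungDiagram) :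
    2 * content μ = (μ.colLen 0 % 2 : ℕ) +
      ((rowList false μ).length - (rowList true μ).length : ℤ) := by
  have h1 (m : ℕ) : ∑ i ∈ range m, (-1 : ℤ) ^ i = (m % 2 : ℕ) := by
    rw [neg_one_geom_sum]
    split_ifs with h
    · rw [Nat.even_iff.1 h, Nat.cast_zero]
    · rw [Nat.not_even_iff.1 h, Nat.cast_one]
  have h2 : ∀ i ∈ range (μ.colLen 0), (-1 : ℤ) ^ (i + μ.rowLen i) =
      (if rowEnd μ i = true then 1 else 0) - (if rowEnd μ i = false then 1 else 0) := by
    intro i hi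
    have := rowLen_pos_iff.2 (mem_range.1 hi)
    rw [rowEnd, label]
    obtain ⟨l, hl⟩ : ∃ l, μ.rowLen i = l + 1 := ⟨μ.rowLen i - 1, by omega⟩
    rw [hl, Nat.add_sub_cancel, ← add_assoc, pow_succ]
    cases hb : (i + l).bodd
    · rw [Even.neg_one_pow]
      · simp
      · rw [Nat.even_iff, Nat.mod_two_of_bodd, hb]; rfl
    · rw [Odd.neg_one_pow]
      · simp
      · rw [Nat.odd_iff, Nat.mod_two_of_bodd, hb]; rfl
  rw [content, sum_cells μ le_rfl (fun i j => (-1 : ℤ) ^ (i + j)), Finset.mul_sum]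
  simp only [two_mul_sum_neg_one_pow]
  rw [Finset.sum_sub_distrib, h1, Finset.sum_congr rfl h2, Finset.sum_sub_distrib, Finset.sum_boole,
    Finset.sum_boole, length_rowList, length_rowList]
  ring

theorem sum_betaSet_quotient (ε : Bool) (μ : YoungDiagram) :
    ∑ a ∈ half (parity (μ.colLen 0) ε) (betaSet (μ.colLen 0) μ), a =
      (quotient ε μ).card + ∑ i ∈ range (rowList ε μ).length, i := by
  rw [← betaSet_quotient, sum_betaSet _ (colLen_quotient_le ε μ)]

theorem card_half_betaSet (ε : Bool) (μ : YoungDiagram) :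
    #(half (parity (μ.colLen 0) ε) (betaSet (μ.colLen 0) μ)) = (rowList ε μ).length := by
  rw [← betaSet_quotient, card_betaSet]

/-- Sum the beta numbers of `μ` by parity: the numbers `r₀`, `r₁` of rows ending in each label enter
only through their difference, which is `2 d` or `2 d - 1`
for `d = content μ`. -/
theorem card_eq_two_mul_quotient_add (μ : YoungDiagram) :
    (μ.card : ℤ) = 2 * ((quotient false μ).card + (quotient true μ).card) +
      content μ * (2 * content μ - 1) := by
  have h0 := sum_betaSet_quotient false μ
  have h1 := sum_betaSet_quotient true μ
  have c0 := card_half_betaSet false μ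
  have c1 := card_half_betaSet true μ
  have hX := sum_betaSet μ le_rfl
  have hm := length_rowList_add μ
  have hd := two_mul_content μ
  have hsplit (r : ℕ) (X : Finset ℕ) : ∑ x ∈ X with x % 2 = r, x =
      2 * ∑ a ∈ half r X, a + r * #(half r X) := by
    rw [sum_half, half, Finset.card_image_of_injOn (half_injOn _ _), mul_comm r, ← smul_eq_mul #_,
      ← Finset.sum_const, Finset.mul_sum, ← Finset.sum_add_distrib]
    refine Finset.sum_congr rfl fun x hx => ?_
    have := (mem_filter.1 hx).2
    omega
  have htri (k : ℕ) : 2 * ((∑ i ∈ range k, i : ℕ) : ℤ) = k * (k - 1) := by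
    induction k with
    | zero => simp
    | succ k ih =>
      rw [Finset.sum_range_succ]
      push_cast at ih ⊢
      linarith
  rw [sum_eq_sum_parity, sum_parity (μ.colLen 0)] at hX
  simp only [hsplit, h0, h1, c0, c1] at hX
  set m := μ.colLen 0
  set r₀ := (rowList false μ).length
  set r₁ := (rowList true μ).length
  have t0 := htri r₀
  have t1 := htri r₁
  have tm := htri m
  zify at hX hm
  rcases Nat.mod_two_eq_zero_or_one m with h | h
  · rw [show parity m false = 0 by simp [parity]; omega,
      show parity m true = 1 by simp [parity]; omega] at hX
    rw [h] at hd
    rw [← hm] at tm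
    push_cast at hX hd t0 t1 tm
    have hr : (r₀ : ℤ) = 2 * content μ + r₁ := by linarith
    rw [hr] at tm t0
    linarith
  · rw [show parity m false = 1 by simp [parity]; omega,
      show parity m true = 0 by simp [parity]; omega] at hX
    rw [h] at hd
    rw [← hm] at tm
    push_cast at hX hd t0 t1 tm
    have hr : (r₀ : ℤ) = 2 * content μ + r₁ - 1 := by linarith
    rw [hr] at tm t0
    linarith

theorem exists_removesDomino_horizontal {μ : YoungDiagram} {i : ℕ}
    (h : μ.rowLen (i + 1) + 2 ≤ μ.rowLen i) : ∃ ν, RemovesDomino μ ν := by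
  have h1 : μ.rowLen (i + 1) < μ.rowLen i := by omega
  have h2 : (eraseCorner μ i h1).rowLen (i + 1) < (eraseCorner μ i h1).rowLen i := by
    simp only [rowLen_eraseCorner, if_true, Nat.succ_ne_self, if_false]
    omega
  refine ⟨eraseCorner _ i h2, i, μ.rowLen i - 2, .inl ⟨?_, ?_, ?_⟩⟩
  · rw [YoungDiagram.mem_iff_lt_rowLen]; omega
  · rw [YoungDiagram.mem_iff_lt_rowLen]; omega
  · rw [cells_eraseCorner, cells_eraseCorner, rowLen_eraseCorner, if_pos rfl,
      show μ.rowLen i - 2 + 1 = μ.rowLen i - 1 by omega,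
      show μ.rowLen i - 1 - 1 = μ.rowLen i - 2 by omega]
    ext c
    simp only [mem_erase, mem_sdiff, mem_insert, mem_singleton]
    tauto

theorem exists_removesDomino_vertical {μ : YoungDiagram} {i : ℕ}
    (h : μ.rowLen (i + 1) = μ.rowLen i) (h' : μ.rowLen (i + 2) < μ.rowLen (i + 1)) :
    ∃ ν, RemovesDomino μ ν := by
  have h2 : (eraseCorner μ (i + 1) h').rowLen (i + 1) < (eraseCorner μ (i + 1) h').rowLen i := by
    rw [rowLen_eraseCorner, rowLen_eraseCorner, if_pos rfl, if_neg (by omega)]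
    omega
  refine ⟨eraseCorner _ i h2, i, μ.rowLen i - 1, .inr ⟨?_, ?_, ?_⟩⟩
  · rw [YoungDiagram.mem_iff_lt_rowLen]; omega
  · rw [YoungDiagram.mem_iff_lt_rowLen]; omega
  · have hi : (eraseCorner μ (i + 1) h').rowLen i = μ.rowLen i := by
      rw [rowLen_eraseCorner, if_neg (by omega)]
    rw [cells_eraseCorner, cells_eraseCorner, hi, h]
    ext c
    simp only [mem_erase, mem_sdiff, mem_insert, mem_singleton]
    tauto

/-- A 2-core is a staircase. -/
theorem IsTwoCore.rowLen_eq {μ : YoungDiagram} (h : IsTwoCore μ) (k : ℕ) (hk : k ≤ μ.colLen 0) :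
    μ.rowLen (μ.colLen 0 - k) = k := by
  induction k using Nat.strong_induction_on with
  | _ k ih =>
    rcases k with _ | k
    · exact rowLen_eq_zero_iff.2 (by omega)
    · have ih1 := ih k (by omega) (by omega)
      set i := μ.colLen 0 - (k + 1) with hi
      rw [show μ.colLen 0 - k = i + 1 by omega] at ih1
      have hpos : 0 < μ.rowLen i := rowLen_pos_iff.2 (by omega)
      have hanti := μ.rowLen_anti i (i + 1) (by omega)
      have hhor : ¬ μ.rowLen (i + 1) + 2 ≤ μ.rowLen i := fun hc =>
        (exists_removesDomino_horizontal hc).elim h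
      have hver : ¬ (μ.rowLen (i + 1) = μ.rowLen i ∧ μ.rowLen (i + 2) < μ.rowLen (i + 1)) :=
        fun hc => (exists_removesDomino_vertical hc.1 hc.2).elim h
      rcases k with _ | k
      · omega
      · have ih2 := ih k (by omega) (by omega)
        rw [show μ.colLen 0 - k = i + 2 by omega] at ih2
        omega

theorem IsTwoCore.card_quotient {μ : YoungDiagram} (h : IsTwoCore μ) (ε : Bool) :
    (quotient ε μ).card = 0 := by
  rw [card_eq_sum_rowLen _ (colLen_quotient_le ε μ), Finset.sum_eq_zero]
  intro k hk
  rw [mem_range] at hk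
  rw [show k = ((⟨k, hk⟩ : Fin _) : ℕ) from rfl, rowLen_quotient]
  have hlt := mem_rowList.1 (List.get_mem (rowList ε μ) ⟨k, hk⟩)
  set i := (rowList ε μ).get ⟨k, hk⟩
  have hrow (j : ℕ) (hj : j < μ.colLen 0) : μ.rowLen j = μ.colLen 0 - j := by
    have := h.rowLen_eq (μ.colLen 0 - j) (by omega)
    rwa [show μ.colLen 0 - (μ.colLen 0 - j) = j by omega] at this
  have hend (j : ℕ) (hj : j < μ.colLen 0) : rowEnd μ j = (μ.colLen 0 - 1).bodd := by
    rw [rowEnd, label, hrow j hj]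
    congr 1
    omega
  have hq := quotientRowLen_add_card hlt.1 hlt.2
  -- All rows end in the same label, so all rows below row `i` are counted.
  rw [Finset.filter_true_of_mem, Nat.card_Ioo, beta, hrow i hlt.1] at hq
  · omega
  · intro j hj
    rw [hend j (mem_Ioo.1 hj).2, ← hlt.2, hend i hlt.1]

theorem content_core (μ : YoungDiagram) : content (core μ) = content μ := by
  have h := (core_spec μ).1
  generalize core μ = ν at h
  induction h with
  | refl => rfl
  | tail _ h ih => rw [h.content_eq, ih]

theorem card_eq_card_core_add (μ : YoungDiagram) :
    μ.card = (core μ).card + 2 * ((quotient false μ).card + (quotient true μ).card) := by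
  have h1 := card_eq_two_mul_quotient_add μ
  have h2 := card_eq_two_mul_quotient_add (core μ)
  rw [(core_spec μ).2.card_quotient, (core_spec μ).2.card_quotient, content_core] at h2
  push_cast at h2
  zify
  linarith

/-! ### The valuation of the dimension and the 2-core tower -/

/-- The recursion for `v₂(|μ|!) - v₂(f^μ)`, the valuation of the product of the hook lengths of `μ`:
passing to the 2-quotient lowers it by the number of cells of the 2-quotient. -/
theorem valuation_recursion (μ : YoungDiagram) :
    padicValNat 2 (dimension μ) + ((quotient false μ).card + (quotient true μ).card) +
        (padicValNat 2 (quotient false μ).card.factorial +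
          padicValNat 2 (quotient true μ).card.factorial) =
      padicValNat 2 μ.card.factorial + (padicValNat 2 (dimension (quotient false μ)) +
        padicValNat 2 (dimension (quotient true μ))) := by
  have h := valuation_frobenius μ le_rfl
  have hε (ε : Bool) := valuation_frobenius _ (colLen_quotient_le ε μ)
  simp only [betaSet_quotient] at hε
  have h0 := hε false
  have h1 := hε true
  rw [valFact_eq, valDiff_eq, sum_parity (μ.colLen 0), sum_parity (μ.colLen 0),
    sum_betaSet_quotient, sum_betaSet_quotient, card_half_betaSet, card_half_betaSet] at h
  omega

theorem rowWeight_zero (μ : YoungDiagram) : rowWeight μ 0 = (core μ).card := by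
  simp [rowWeight, iteratedQuotient]

theorem rowWeight_succ (μ : YoungDiagram) (k : ℕ) :
    rowWeight μ (k + 1) = rowWeight (quotient false μ) k + rowWeight (quotient true μ) k := by
  rw [rowWeight, ← (Fin.consEquiv (fun _ => Bool)).sum_comp, Fintype.sum_prod_type,
    Fintype.sum_bool, add_comm]
  simp [rowWeight, iteratedQuotient, Fin.consEquiv, List.ofFn_succ]

theorem two_pow_mul_rowWeight_le (μ : YoungDiagram) (k : ℕ) : 2 ^ k * rowWeight μ k ≤ μ.card := by
  induction k generalizing μ with
  | zero =>
    have := card_eq_card_core_add μ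
    rw [rowWeight_zero]
    omega
  | succ k ih =>
    have := card_eq_card_core_add μ
    have h0 := ih (quotient false μ)
    have h1 := ih (quotient true μ)
    rw [rowWeight_succ, pow_succ, mul_comm (2 ^ k), mul_assoc, mul_add]
    omega

theorem rowWeight_eq_zero {μ : YoungDiagram} {k : ℕ} (hk : μ.card < k) : rowWeight μ k = 0 := by
  have h := two_pow_mul_rowWeight_le μ k
  by_contra h0
  have := Nat.le_mul_of_pos_right (2 ^ k) (Nat.pos_of_ne_zero h0)
  have := k.lt_two_pow_self
  omega

theorem sum_two_pow_mul_rowWeight (N : ℕ) (μ : YoungDiagram) (hN : μ.card ≤ N) :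
    ∑ k ∈ range (N + 1), 2 ^ k * rowWeight μ k = μ.card := by
  induction N generalizing μ with
  | zero =>
    have := card_eq_card_core_add μ
    rw [Finset.sum_range_one, rowWeight_zero]
    omega
  | succ N ih =>
    have := card_eq_card_core_add μ
    rw [Finset.sum_range_succ']
    simp only [rowWeight_succ, rowWeight_zero, pow_succ, mul_comm _ 2, mul_assoc, mul_add]
    rw [Finset.sum_add_distrib, ← Finset.mul_sum, ← Finset.mul_sum, ih _ (by omega),
      ih _ (by omega)]
    omega

/-- Both `|μ| + v₂(f^μ) - v₂(|μ|!)` and `∑ w_k(μ)` exceed the sum of their values at the two components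
of the 2-quotient by `|core μ|`. -/
theorem valuation_dimension_add_card (N : ℕ) (μ : YoungDiagram) (hN : μ.card ≤ N) :
    padicValNat 2 (dimension μ) + μ.card =
      padicValNat 2 μ.card.factorial + ∑ k ∈ range (N + 1), rowWeight μ k := by
  induction N generalizing μ with
  | zero =>
    have := card_eq_card_core_add μ
    have h0 : μ.card = 0 := by omega
    rw [Finset.sum_range_one, rowWeight_zero, dimension_of_card_eq_zero h0, h0]
    simp
    omega
  | succ N ih =>
    have := card_eq_card_core_add μ
    have := valuation_recursion μ
    have h0 := ih (quotient false μ) (by omega)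
    have h1 := ih (quotient true μ) (by omega)
    rw [Finset.sum_range_succ']
    simp only [rowWeight_succ, rowWeight_zero]
    rw [Finset.sum_add_distrib]
    omega

/-! ### Binary digits -/

theorem binDigit_zero (n : ℕ) : binDigit n 0 = n % 2 := by
  rw [binDigit, Nat.testBit_zero]
  rcases Nat.mod_two_eq_zero_or_one n with h | h <;> simp [h]

theorem binDigit_succ (n i : ℕ) : binDigit n (i + 1) = binDigit (n / 2) i := by
  rw [binDigit, binDigit, Nat.testBit_succ]

theorem binDigit_eq_zero {n i : ℕ} (h : n ≤ i) : binDigit n i = 0 := by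
  rw [binDigit, Nat.testBit_lt_two_pow (h.trans_lt i.lt_two_pow_self)]
  rfl

/-- Legendre's formula for the prime `2`. -/
theorem valuation_factorial_add_sum_binDigit (N n : ℕ) (hN : n ≤ N) :
    padicValNat 2 n.factorial + ∑ i ∈ range (N + 1), binDigit n i = n := by
  induction N generalizing n with
  | zero =>
    obtain rfl : n = 0 := by omega
    simp [binDigit]
  | succ N ih =>
    have := ih (n / 2) (by omega)
    rw [Finset.sum_range_succ']
    simp only [binDigit_succ, binDigit_zero]
    conv_lhs => enter [1]; rw [← Nat.div_add_mod n 2]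
    rw [padicValNat_factorial_mul_add _ (Nat.mod_lt n two_pos), padicValNat_factorial_mul]
    omega

theorem valuation_dimension (N : ℕ) (μ : YoungDiagram) (hN : μ.card ≤ N) :
    padicValNat 2 (dimension μ) + ∑ i ∈ range (N + 1), binDigit μ.card i =
      ∑ k ∈ range (N + 1), rowWeight μ k := by
  have := valuation_dimension_add_card N μ hN
  have := valuation_factorial_add_sum_binDigit N μ.card hN
  omega

/-- Carrying `w 0 / 2` from position `0` to position `1`, and then dropping position `0`. -/
def carry (w : ℕ → ℕ) (i : ℕ) : ℕ := w (i + 1) + if i = 0 then w 0 / 2 else 0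

section Carry

variable {N n : ℕ} {w : ℕ → ℕ}

theorem sum_mul_carry (hn : n < 2 ^ (N + 1)) (hw : ∑ i ∈ range (N + 1), 2 ^ i * w i = n)
    (f : ℕ → ℕ) : ∑ i ∈ range N, f i * carry w i =
      ∑ i ∈ range N, f i * w (i + 1) + f 0 * (w 0 / 2) := by
  simp only [carry, mul_add, Finset.sum_add_distrib, mul_ite, mul_zero]
  rw [Finset.sum_ite_eq', add_right_inj]
  split_ifs with h
  · rfl
  · obtain rfl : N = 0 := by simpa using h
    rw [Finset.sum_range_one] at hw
    rw [show w 0 / 2 = 0 by omega, mul_zero]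

theorem mod_two_eq (hw : ∑ i ∈ range (N + 1), 2 ^ i * w i = n) : n % 2 = w 0 % 2 := by
  rw [Finset.sum_range_succ'] at hw
  simp only [pow_succ, mul_comm _ 2, mul_assoc] at hw
  rw [← Finset.mul_sum] at hw
  omega

theorem sum_two_pow_mul_carry (hn : n < 2 ^ (N + 1))
    (hw : ∑ i ∈ range (N + 1), 2 ^ i * w i = n) :
    ∑ i ∈ range N, 2 ^ i * carry w i = n / 2 := by
  rw [sum_mul_carry hn hw]
  rw [Finset.sum_range_succ'] at hw
  simp only [pow_succ, mul_comm _ 2, mul_assoc] at hw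
  rw [← Finset.mul_sum] at hw
  omega

theorem sum_carry (hn : n < 2 ^ (N + 1)) (hw : ∑ i ∈ range (N + 1), 2 ^ i * w i = n) :
    ∑ i ∈ range (N + 1), w i = ∑ i ∈ range N, carry w i + w 0 / 2 + w 0 % 2 := by
  have := sum_mul_carry hn hw (fun _ => 1)
  simp only [one_mul] at this
  rw [this, Finset.sum_range_succ']
  omega

theorem carry_eq_zero (hn : n < 2 ^ (N + 1)) (hw : ∑ i ∈ range (N + 1), 2 ^ i * w i = n)
    (h0 : ∀ i, N + 1 ≤ i → w i = 0) (i : ℕ) (hi : N ≤ i) : carry w i = 0 := by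
  rw [carry, h0 (i + 1) (by omega), zero_add]
  split_ifs with h
  · subst h
    obtain rfl : N = 0 := by omega
    rw [Finset.sum_range_one] at hw
    omega
  · rfl

/-- Among all expansions of `n` with coefficients `w i ≥ 0` in powers of `2`, the binary expansion is
the unique one with the least sum of coefficients. -/
theorem sum_binDigit_le (hn : n < 2 ^ N) (hw : ∑ i ∈ range N, 2 ^ i * w i = n)
    (h0 : ∀ i, N ≤ i → w i = 0) :
    ∑ i ∈ range N, binDigit n i ≤ ∑ i ∈ range N, w i ∧
      (∑ i ∈ range N, w i = ∑ i ∈ range N, binDigit n i → ∀ i, w i = binDigit n i) := by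
  induction N generalizing n w with
  | zero =>
    obtain rfl : n = 0 := by simpa using hn
    simp only [Finset.range_zero, Finset.sum_empty, le_refl, true_and, forall_const]
    intro i
    rw [h0 i (Nat.zero_le i), binDigit_eq_zero (Nat.zero_le i)]
  | succ N ih =>
    obtain ⟨h1, h2⟩ := ih (n := n / 2) (w := carry w) (by omega)
      (sum_two_pow_mul_carry hn hw) (carry_eq_zero hn hw h0)
    have hpar := mod_two_eq hw
    rw [sum_carry hn hw, Finset.sum_range_succ']
    simp only [binDigit_succ, binDigit_zero]
    refine ⟨by omega, fun h => ?_⟩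
    have hc : w 0 / 2 = 0 := by omega
    have h3 := h2 (by omega)
    rintro (_ | i)
    · rw [binDigit_zero]
      omega
    · rw [binDigit_succ, ← h3, carry, hc]
      simp

/-- If the sum of the coefficients exceeds the least possible one by `1`, then a single carry turns
the expansion into the binary one. -/
theorem exists_carry_position (hn : n < 2 ^ N) (hw : ∑ i ∈ range N, 2 ^ i * w i = n)
    (h0 : ∀ i, N ≤ i → w i = 0)
    (hs : ∑ i ∈ range N, w i = ∑ i ∈ range N, binDigit n i + 1) :
    ∃ r, binDigit n (r + 1) = 1 ∧ w r = binDigit n r + 2 ∧ w (r + 1) = 0 ∧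
      ∀ i, i ≠ r + 1 → i ≠ r → w i = binDigit n i := by
  induction N generalizing n w with
  | zero => simp at hs
  | succ N ih =>
    have hn' : n / 2 < 2 ^ N := by omega
    have hw' := sum_two_pow_mul_carry hn hw
    have h0' := carry_eq_zero hn hw h0
    have hpar := mod_two_eq hw
    rw [sum_carry hn hw, Finset.sum_range_succ'] at hs
    simp only [binDigit_succ, binDigit_zero] at hs
    by_cases hc : w 0 / 2 = 0
    · have hcarry (i) : carry w i = w (i + 1) := by simp [carry, hc]
      obtain ⟨r, h1, h2, h3, h4⟩ := ih hn' hw' h0' (by omega)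
      simp only [hcarry] at h2 h3 h4
      refine ⟨r + 1, by rw [binDigit_succ, h1], by rw [binDigit_succ, h2], h3, ?_⟩
      rintro (_ | i) h5 h6
      · rw [binDigit_zero]
        omega
      · rw [binDigit_succ]
        exact h4 i (by omega) (by omega)
    · obtain ⟨h1, h2⟩ := sum_binDigit_le hn' hw' h0'
      have h3 := h2 (by omega)
      have h4 := h3 0
      have h5 : binDigit (n / 2) 0 < 2 := by
        rw [binDigit_zero]
        omega
      simp only [carry, zero_add, if_true] at h4
      refine ⟨0, ?_, ?_, ?_, ?_⟩
      · rw [binDigit_succ]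
        omega
      · rw [binDigit_zero]
        omega
      · rw [zero_add]
        omega
      · rintro (_ | i) h6 h7
        · omega
        · rw [binDigit_succ, ← h3 i, carry, if_neg (by omega), add_zero]

theorem sum_eq_of_carry_position {r : ℕ} (hr : r + 1 < N) (h1 : binDigit n (r + 1) = 1)
    (h2 : w r = binDigit n r + 2) (h3 : w (r + 1) = 0)
    (h4 : ∀ i, i ≠ r + 1 → i ≠ r → w i = binDigit n i) :
    ∑ i ∈ range N, w i = ∑ i ∈ range N, binDigit n i + 1 := by
  have h : ∑ i ∈ range N, (w i + if i = r + 1 then 1 else 0) =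
      ∑ i ∈ range N, (binDigit n i + if i = r then 2 else 0) := by
    refine Finset.sum_congr rfl fun i _ => ?_
    by_cases hi : i = r + 1
    · subst hi
      simp [h1, h3]
    · by_cases hi' : i = r
      · subst hi'
        simp [h2]
      · simp [hi, hi', h4 i hi hi']
  rw [Finset.sum_add_distrib, Finset.sum_add_distrib, Finset.sum_ite_eq', Finset.sum_ite_eq',
    if_pos (mem_range.2 hr), if_pos (mem_range.2 (by omega))] at h
  omega

end Carry

end TwoCoreTower

theorem proposition3p1 (n : ℕ) (lam : YoungDiagram) (hlam : lam.card = n) :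
    padicValNat 2 (TwoCoreTower.dimension lam) = 1 ↔
      ∃ R ∈ TwoCoreTower.bin' n,
        TwoCoreTower.rowWeight lam (R - 1) = TwoCoreTower.binDigit n (R - 1) + 2 ∧
        TwoCoreTower.rowWeight lam R = 0 ∧
        ∀ i : ℕ, i ≠ R → i ≠ R - 1 →
          TwoCoreTower.rowWeight lam i = TwoCoreTower.binDigit n i := by
  subst hlam
  have hval := TwoCoreTower.valuation_dimension lam.card lam le_rfl
  constructor
  · intro h
    have hn : lam.card < 2 ^ (lam.card + 1) :=
      lam.card.lt_succ_self.trans (lam.card + 1).lt_two_pow_self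
    obtain ⟨r, h1, h2, h3, h4⟩ := TwoCoreTower.exists_carry_position hn
      (TwoCoreTower.sum_two_pow_mul_rowWeight _ lam le_rfl)
      (fun i hi => TwoCoreTower.rowWeight_eq_zero hi) (by omega)
    exact ⟨r + 1, ⟨h1, by simp⟩, h2, h3, h4⟩
  · rintro ⟨R, ⟨h1, hR⟩, h2, h3, h4⟩
    obtain ⟨r, rfl⟩ : ∃ r, R = r + 1 := ⟨R - 1, by simp at hR; omega⟩
    have hr : r + 1 < lam.card + 1 := by
      by_contra hc
      have h5 : TwoCoreTower.binDigit lam.card (r + 1) = 1 := h1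
      rw [TwoCoreTower.binDigit_eq_zero (by omega)] at h5
      omega
    have := TwoCoreTower.sum_eq_of_carry_position hr h1 h2 h3 h4
    omega
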